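/- Let $L\ge 0$ be an integer and let $V$ be the Fock space of electrons with spin $\uparrow$ or $\downarrow$ on $L$ sites, i.e. the exterior algebra of the $2L$-dimensional complex vector space with basis $\{1,\dots,L\}\times\{\uparrow,\downarrow\}$. For an integer $a$ and $k\ge 0$ write $\binom{a}{k}=a(a-1)\cdots(a-k+1)/k!$. For integers $N,M\ge 0$ define $$Z(L;N,M)=\sum\binom{L}{N_r}\prod_{n\ge1}\binom{P'_n+M'_n}{M'_n}\binom{P_n+M_n}{M_n},\qquad \widetilde Z(L;N,M)=\sum\binom{L}{N_r}\prod_{n\ge1}\binom{P'_n+M'_n+n}{M'_n}\binom{P_n+M_n}{M_n},$$ where both sums run over all $N_r\ge0$ and all families of non-negative integers $(M_n)_{n\ge1}$, $(M'_n)_{n\ge1}$ with finitely many non-zero entries that satisfy $N=N_r+2\sum_{n\ge1}nM'_n$ and $M=\sum_{n\ge1}n(M_n+M'_n)$, and where $$P'_n=L-N+2\sum_{m>n}(m-n)M'_m,\qquad P_n=N-2M+2\sum_{m>n}(m-n)M_m.$$ Then $\dim V=4^L$, and (i) $\displaystyle \dim V=4^L=\sum_{0\le N\le L}\ \sum_{0\le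 M\le\lfloor N/2\rfloor}(L-N+1)(N-2M+1)\,Z(L;N,M)$; (ii) $\displaystyle \dim V=4^L=\sum_{0\le N\le 2L}\ \sum_{0\le M\le\lfloor N/2\rfloor}(N-2M+1)\,\widetilde Z(L;N,M)$. -/

import Mathlib

namespace HubbardBethe

/-- The Fock space of electrons on `L` sites, each electron having one of two spins: the exterior
algebra on the one-electron space `ℂ ^ (sites × spins)` (the vacuum is `1`, and the creation
operator of an electron in the state `e` is left multiplication by `ι e`). -/
abbrev FockSpace (L : ℕ) : Type :=
  ExteriorAlgebra ℂ (Fin L × Fin 2 → ℂ)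

/-- String multiplicities: finitely supported families `(M_n)_{n ≥ 1}` of natural numbers. -/
abbrev StringMult : Type := ℕ+ →₀ ℕ

/-- The weight `∑_{n ≥ 1} n M_n`. -/
def weight (f : StringMult) : ℕ := f.sum fun n k => (n : ℕ) * k

/-- The sum `2 ∑_{m > n} (m - n) M_m`. -/
def excess (f : StringMult) (n : ℕ+) : ℤ :=
  2 * f.sum fun m k => if n < m then (((m : ℕ) : ℤ) - ((n : ℕ) : ℤ)) * (k : ℤ) else 0

/-- A configuration `(N_r, (M_n), (M'_n))`. -/
structure Config : Type where
  /-- the number of real wave numbers -/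
  Nr : ℕ
  /-- the numbers `M_n` -/
  M : StringMult
  /-- the numbers `M'_n` -/
  M' : StringMult

/-- The configurations with `N = N_r + 2 ∑ n M'_n` and `M = ∑ n (M_n + M'_n)`. -/
def configs (N M : ℕ) : Set Config :=
  {c | N = c.Nr + 2 * weight c.M' ∧ M = weight c.M + weight c.M'}

theorem finite_weight_le (B : ℕ) : {f : StringMult | weight f ≤ B}.Finite := by
  let s : Finset ℕ+ := Finset.Icc 1 B.succPNat
  let g : StringMult := Finsupp.onFinset s (fun n => if n ∈ s then B else 0) (by
    intro n hn
    by_contra h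
    simp [h] at hn)
  refine (Set.finite_Iic g).subset ?_
  intro f hf n
  have hle : (n : ℕ) * f n ≤ B := by
    by_cases hn : n ∈ f.support
    · exact (Finset.single_le_sum (f := fun m : ℕ+ => (m : ℕ) * f m)
        (fun _ _ => Nat.zero_le _) hn).trans hf
    · simp [Finsupp.notMem_support_iff.mp hn]
  by_cases h0 : f n = 0
  · simp [h0]
  have hn1 : (n : ℕ) ≤ B :=
    (Nat.le_mul_of_pos_right _ (Nat.pos_of_ne_zero h0)).trans hle
  have hfB : f n ≤ B := (Nat.le_mul_of_pos_left _ n.pos).trans hle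
  have hns : n ∈ s := by
    refine Finset.mem_Icc.mpr ⟨one_le, ?_⟩
    rw [← PNat.coe_le_coe, Nat.succPNat_coe]
    omega
  simpa [g, hns] using hfB

theorem configs_finite (N M : ℕ) : (configs N M).Finite := by
  have h : ((Set.Iic N) ×ˢ ({f : StringMult | weight f ≤ M} ×ˢ
      {f : StringMult | weight f ≤ M})).Finite :=
    (Set.finite_Iic N).prod ((finite_weight_le M).prod (finite_weight_le M))
  refine (h.image fun p => Config.mk p.1 p.2.1 p.2.2).subset ?_
  rintro ⟨a, b, c⟩ ⟨h1, h2⟩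
  refine ⟨(a, b, c), ⟨?_, ?_, ?_⟩, rfl⟩ <;> simp only [Set.mem_Iic, Set.mem_ofPred_eq] at * <;> omega

/-- `P_n = N - 2M + 2 ∑_{m > n} (m - n) M_m`. -/
def P (N M : ℕ) (c : Config) (n : ℕ+) : ℤ := (N : ℤ) - 2 * (M : ℤ) + excess c.M n

/-- `P'_n = L - N + 2 ∑_{m > n} (m - n) M'_m`. -/
def P' (L N : ℕ) (c : Config) (n : ℕ+) : ℤ := (L : ℤ) - (N : ℤ) + excess c.M' n

/-- `Z(L; N, M)`. The products run over all `n ≥ 1`: the factors with `M_n = 0` or `M'_n = 0`,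
which `Finsupp.prod` leaves out, are `1`. The binomial coefficient `Ring.choose a k` is
`a (a - 1) ⋯ (a - k + 1) / k!` for every integer `a`. -/
noncomputable def Z (L N M : ℕ) : ℤ :=
  ∑ c ∈ (configs_finite N M).toFinset,
    (L.choose c.Nr : ℤ) *
      ((c.M'.prod fun n k => Ring.choose (P' L N c n + (k : ℤ)) k) *
        (c.M.prod fun n k => Ring.choose (P N M c n + (k : ℤ)) k))

/-- `Z̃(L; N, M)`, which differs from `Z(L; N, M)` by the extra summand `n` in the upper entry of
the binomial coefficients belonging to the `M'_n`. -/
noncomputable def Ztilde (L N M : ℕ) : ℤ :=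
  ∑ c ∈ (configs_finite N M).toFinset,
    (L.choose c.Nr : ℤ) *
      ((c.M'.prod fun n k => Ring.choose (P' L N c n + (k : ℤ) + ((n : ℕ) : ℤ)) k) *
        (c.M.prod fun n k => Ring.choose (P N M c n + (k : ℤ)) k))

end HubbardBethe

namespace HubbardBethe

open Finset

/-! Put `r = N_r`, `w = ∑ n M'_n`, `m = ∑ n M_n`. Then `L - N = (L - r) - 2w` and `N - 2M = r - 2m`,
so for fixed `r, w, m` the sums over the two families separate. Each is Bethe's count for a spin
chain: over the families of weight `m`, the unshifted products sum to `C(a, m) - C(a, m - 1)`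
(`sum_stringProd_zero`) and the shifted ones to `C(a, m)` (`sum_stringProd_one`), for every integer
`a`.

Both counts are refined by the number `q` of strings. Shortening every string by one gives a
recursion (`stringSum_recursion`), which explicit closed forms satisfy by a Pfaff–Saalschütz
identity; summing over `q` is Vandermonde.

In (i), `∑ (l - 2m + 1)(C(l, m) - C(l, m - 1)) = 2 ^ l` applies to `l = r` and `l = L - r`; in (ii)
the primed factor is a full binomial row. Either way `∑ C(L, r) 2 ^ (L - r) 2 ^ r = 4 ^ L` remains.
-/

theorem finrank_fockSpace (L : ℕ) : Module.finrank ℂ (FockSpace L) = 4 ^ L := by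
  let e : Fin L × Fin 2 ≃ Fin (L * 2) := finProdFinEquiv
  let b := ((Pi.basisFun ℂ (Fin L × Fin 2)).reindex e).ExteriorAlgebra
  rw [Module.finrank_eq_card_basis b, Fintype.card_finset, Fintype.card_fin, mul_comm, pow_mul]
  norm_num

/-! ### Binomial identities -/

theorem choose_add_eq_sum_range (r s : ℤ) (k : ℕ) :
    Ring.choose (r + s) k = ∑ j ∈ range (k + 1), Ring.choose r (k - j) * Ring.choose s j := by
  rw [add_comm, Ring.add_choose_eq k (Commute.all s r),
    Nat.sum_antidiagonal_eq_sum_range_succ_mk]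
  exact sum_congr rfl fun j _ => mul_comm _ _

theorem natChoose_mul_comm (n j p : ℕ) :
    n.choose j * (n - j).choose p = n.choose p * (n - p).choose j := by
  have h₁ := Nat.choose_mul (n := n) (Nat.le_add_right j p)
  have h₂ := Nat.choose_mul (n := n) (Nat.le_add_left p j)
  rw [Nat.add_sub_cancel_left] at h₁
  rw [Nat.add_sub_cancel] at h₂
  rw [← h₁, ← h₂, Nat.choose_symm_add]

/-- A form of the Pfaff–Saalschütz identity. The second hypothesis is the Vandermonde identity for
the coefficients `c`. -/
theorem sum_choose_mul_choose_mul (y : ℤ) (q t p : ℕ) (c : ℕ → ℤ)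
    (hc : ∀ i, ∑ k ∈ range (i + 1), (i.choose k : ℤ) * c k = ((i + t).choose p : ℤ)) :
    ∑ k ∈ range (q + 1), Ring.choose (y + q + t - k) (q - k) * Ring.choose y k * c k =
      ((q + t).choose p : ℤ) * Ring.choose (y + ((q + t - p : ℕ) : ℤ)) q := by
  -- Vandermonde splits off `q + t`; trinomial revision of the two factors in `y` then leaves `k`
  -- only in `(q - j).choose k * c k`, which `hc` can sum.
  have h₁ : ∀ k ∈ range (q + 1),
      Ring.choose (y + q + t - k) (q - k) * Ring.choose y k * c k =
        ∑ j ∈ range (q - k + 1), Ring.choose y (q - j) * ((q + t).choose j : ℤ) *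
          (((q - j).choose k : ℤ) * c k) := by
    intro k hk
    rw [show y + q + t - k = (y - k) + ((q + t : ℕ) : ℤ) by push_cast; ring,
      choose_add_eq_sum_range, sum_mul, sum_mul]
    refine sum_congr rfl fun j hj => ?_
    simp only [mem_range] at hk hj
    have h := Ring.choose_smul_choose y (show k ≤ q - j by omega)
    rw [nsmul_eq_mul] at h
    rw [Ring.choose_natCast, show q - k - j = q - j - k by omega]
    linear_combination -((q + t).choose j * c k : ℤ) * h
  have h₂ : ∀ j ∈ range (q + 1),
      ∑ k ∈ range (q - j + 1), Ring.choose y (q - j) * ((q + t).choose j : ℤ) *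
          (((q - j).choose k : ℤ) * c k) =
        ((q + t).choose p : ℤ) * (Ring.choose y (q - j) *
          Ring.choose ((q + t - p : ℕ) : ℤ) j) := by
    intro j hj
    have hj' : q - j + t = q + t - j := by simp only [mem_range] at hj; omega
    have h : ((q + t).choose j : ℤ) * ((q + t - j).choose p : ℤ) =
        ((q + t).choose p : ℤ) * ((q + t - p).choose j : ℤ) :=
      mod_cast natChoose_mul_comm (q + t) j p
    rw [← mul_sum, hc, Ring.choose_natCast, hj']
    linear_combination Ring.choose y (q - j) * h
  rw [sum_congr rfl h₁, choose_add_eq_sum_range, mul_sum, ← sum_congr rfl h₂]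
  refine sum_comm' fun k j => ?_
  simp only [mem_range]
  omega

theorem sum_choose_mul_choose_succ (i s : ℕ) :
    ∑ k ∈ range (i + 1), (i.choose k : ℤ) * (s.choose (k + 1) : ℤ) =
      ((i + s).choose (i + 1) : ℤ) := by
  rw [add_comm i s, Nat.add_choose_eq, Nat.sum_antidiagonal_eq_sum_range_succ_mk,
    sum_range_succ' _ (i + 1), Nat.sub_zero, Nat.choose_succ_self, mul_zero, add_zero]
  push_cast
  refine sum_congr rfl fun k hk => ?_
  simp only [mem_range] at hk
  rw [Nat.choose_symm (by omega), mul_comm]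

/-- The number of compositions of `m` into `q` positive parts. -/
def compositionCount : ℕ → ℕ → ℕ
  | 0, 0 => 1
  | 0, _ + 1 => 0
  | _ + 1, 0 => 0
  | m + 1, q + 1 => m.choose q

theorem compositionCount_succ_succ (m q : ℕ) :
    compositionCount (m + 1) (q + 1) = m.choose q := rfl

theorem sum_choose_mul_compositionCount (i u : ℕ) :
    ∑ k ∈ range (i + 1), (i.choose k : ℤ) * (compositionCount (u + 1) k : ℤ) =
      ((i + u).choose (u + 1) : ℤ) := by
  rw [sum_range_succ', add_comm i u, ← sum_choose_mul_choose_succ]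
  simp only [compositionCount, Nat.cast_zero, mul_zero, add_zero]
  have h₁ : range i ⊆ range (max i (u + 1)) := range_subset_range.2 (le_max_left _ _)
  have h₂ : range (u + 1) ⊆ range (max i (u + 1)) := range_subset_range.2 (le_max_right _ _)
  rw [sum_subset h₁, sum_subset h₂]
  · exact sum_congr rfl fun _ _ => mul_comm _ _
  · intro k _ hk
    rw [Nat.choose_eq_zero_of_lt (by simpa [mem_range] using hk)]
    simp
  · intro k _ hk
    rw [Nat.choose_eq_zero_of_lt (by simp only [mem_range] at hk; omega)]
    simp

/-! ### Closed forms for a fixed number of strings -/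

/-- The contribution of the families of weight `m` with `q` strings, with the shift `n` in the
binomial coefficients. -/
def shiftedClosed (a : ℤ) (m q : ℕ) : ℤ :=
  Ring.choose (a - m + 1) q * compositionCount m q

/-- The term by which the contribution without shift differs from `shiftedClosed`. -/
def correction (a : ℤ) (m : ℕ) : ℕ → ℤ
  | 0 => 0
  | q + 1 => Ring.choose (a - m) q * m.choose (q + 1)

theorem shiftedClosed_recursion (a : ℤ) (s q : ℕ) (hq : q ≠ 0) :
    ∑ k ∈ range (q + 1), Ring.choose (a + 1 - q - k) (q - k) *
      shiftedClosed (a + 1 - 2 * q) s k = shiftedClosed a (s + q) q := by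
  obtain ⟨r, rfl⟩ := Nat.exists_eq_succ_of_ne_zero hq
  cases s with
  | zero =>
    rw [Nat.zero_add, sum_eq_single 0]
    · simp only [shiftedClosed, Nat.succ_eq_add_one, Nat.choose_self, Ring.choose_zero_right,
        Nat.sub_zero, compositionCount]
      push_cast
      ring_nf
    · rintro (_ | k) _ hk
      · exact absurd rfl hk
      · simp [shiftedClosed, compositionCount]
    · simp
  | succ u =>
    have h := sum_choose_mul_choose_mul (a + 1 - (u + 1 : ℕ) - 2 * (r + 1 : ℕ) + 1) (r + 1) u
      (u + 1) (fun k => compositionCount (u + 1) k) (fun i => sum_choose_mul_compositionCount i u)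
    simp only [shiftedClosed]
    rw [show (u + 1 + r.succ) = (u + 1 + r) + 1 by omega, compositionCount]
    have e₁ : r + 1 + u - (u + 1) = r := by omega
    rw [e₁, show r + 1 + u = u + 1 + r by omega, Nat.choose_symm_add] at h
    refine Eq.trans (sum_congr rfl fun k _ => ?_) (h.trans ?_)
    · rw [mul_assoc]
      congr 2
      · push_cast
        ring
      · congr 1
        push_cast
        ring
    · rw [mul_comm]
      congr 2
      push_cast
      ring

theorem correction_recursion (a : ℤ) (s q : ℕ) (hq : q ≠ 0) :
    ∑ k ∈ range (q + 1), Ring.choose (a - q - k) (q - k) *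
      correction (a - 2 * q) s k =
        Ring.choose (a - (s + q : ℕ)) (q - 1) * ((s + q - 1).choose q : ℤ) := by
  obtain ⟨r, rfl⟩ := Nat.exists_eq_succ_of_ne_zero hq
  rw [sum_range_succ']
  simp only [correction, mul_zero, add_zero]
  cases s with
  | zero => simp
  | succ u =>
    have h := sum_choose_mul_choose_mul (a - 2 * (r + 1 : ℕ) - (u + 1 : ℕ)) r (u + 1) u
      (fun k => (u + 1).choose (k + 1)) (fun i => by
        rw [sum_choose_mul_choose_succ, ← Nat.choose_symm_of_eq_add]
        omega)
    rw [show r + (u + 1) - u = r + 1 by omega] at h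
    refine Eq.trans (sum_congr rfl fun k _ => ?_) (h.trans ?_)
    · rw [mul_assoc]
      congr 2
      · push_cast
        ring
      · omega
    · rw [mul_comm]
      congr 2
      · push_cast
        ring
      · rw [show u + 1 + r.succ - 1 = r + (u + 1) by omega]
        symm
        apply Nat.choose_symm_of_eq_add
        omega

/-- The shifted recursion is used at `a - 1` to match the upper entries. After Pascal's rule in both
`a - m + 1` and `m` (with `m = s + q`), the cross terms cancel. The difference is Bethe's `(a - 2m +
1) / (a - m + 1) * C(a - m + 1, q) * C(m - 1, q - 1)` for `m, q ≥ 1`, written without division. -/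
theorem closed_recursion (a : ℤ) (s q : ℕ) (hq : q ≠ 0) :
    ∑ k ∈ range (q + 1), Ring.choose (a - q - k) (q - k) *
      (shiftedClosed (a - 2 * q) s k - correction (a - 2 * q) s k) =
        shiftedClosed a (s + q) q - correction a (s + q) q := by
  simp only [mul_sub, sum_sub_distrib]
  rw [correction_recursion a s q hq]
  have h := shiftedClosed_recursion (a - 1) s q hq
  simp only [sub_add_cancel] at h
  rw [h]
  obtain ⟨r, rfl⟩ := Nat.exists_eq_succ_of_ne_zero hq
  simp only [shiftedClosed, correction, Nat.succ_eq_add_one, ← add_assoc, compositionCount_succ_succ,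
    Nat.add_sub_cancel]
  rw [show a - 1 - ((s + r + 1 : ℕ) : ℤ) + 1 = a - ((s + r + 1 : ℕ) : ℤ) by ring,
    Ring.choose_succ_succ, Nat.choose_succ_succ]
  push_cast
  ring

/-- Vandermonde for `a = (m - 1) + (a - m + 1)`; `m = 0` is separate. -/
theorem sum_shiftedClosed (a : ℤ) (m : ℕ) :
    ∑ q ∈ range (m + 1), shiftedClosed a m q = Ring.choose a m := by
  cases m with
  | zero => simp [shiftedClosed, compositionCount]
  | succ u =>
    have h := choose_add_eq_sum_range ((u : ℕ) : ℤ) (a - u) (u + 1)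
    rw [add_sub_cancel] at h
    rw [h]
    refine sum_congr rfl fun q hq => ?_
    simp only [mem_range] at hq
    rw [shiftedClosed, Ring.choose_natCast, mul_comm]
    congr 2
    · cases q with
      | zero => simp [compositionCount]
      | succ r =>
        rw [compositionCount, Nat.add_sub_add_right, Nat.choose_symm (by omega)]
    · push_cast
      ring

theorem sum_correction (a : ℤ) (m : ℕ) :
    ∑ q ∈ range (m + 1 + 1), correction a (m + 1) q = Ring.choose a m := by
  rw [sum_range_succ']
  have h := choose_add_eq_sum_range ((m + 1 : ℕ) : ℤ) (a - (m + 1 : ℕ)) m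
  rw [add_sub_cancel] at h
  rw [h]
  simp only [correction, add_zero]
  refine sum_congr rfl fun q hq => ?_
  simp only [mem_range] at hq
  rw [mul_comm, Ring.choose_natCast, ← Nat.choose_symm (show q + 1 ≤ m + 1 by omega),
    Nat.add_sub_add_right]

/-- The coefficient `C(l, m) - C(l, m - 1)`: the number of highest weight vectors with `m` reversed
spins in a chain of `l` spins one half. -/
def ballot (l : ℤ) : ℕ → ℤ
  | 0 => 1
  | m + 1 => Ring.choose l (m + 1) - Ring.choose l m

theorem sum_closed (a : ℤ) (m : ℕ) :
    ∑ q ∈ range (m + 1), (shiftedClosed a m q - correction a m q) = ballot a m := by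
  rw [sum_sub_distrib, sum_shiftedClosed]
  cases m with
  | zero => simp [correction, ballot]
  | succ m => rw [sum_correction, ballot]

/-- Summation by parts: consecutive weights differ by 2. -/
theorem sum_mul_ballot_partial (l h : ℕ) :
    ∑ m ∈ range (h + 1), ((l : ℤ) - 2 * m + 1) * ballot l m =
      ((l : ℤ) - 2 * h - 1) * l.choose h + 2 * ∑ m ∈ range (h + 1), (l.choose m : ℤ) := by
  induction h with
  | zero => simp [ballot]; ring
  | succ h ih =>
    rw [sum_range_succ, ih, sum_range_succ _ (h + 1), ballot, Ring.choose_natCast,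
      Ring.choose_natCast]
    push_cast
    ring

theorem sum_mul_ballot (l : ℕ) :
    ∑ m ∈ range (l / 2 + 1), ((l : ℤ) - 2 * m + 1) * ballot l m = 2 ^ l := by
  rw [sum_mul_ballot_partial]
  obtain ⟨h, rfl | rfl⟩ := Nat.even_or_odd' l
  · rw [Nat.mul_div_cancel_left _ two_pos]
    -- Pascal's rule turns this half row into twice the half row of `2 * h` minus `C(2h, h)`, which
    -- is exactly the boundary term.
    have h₁ : ∑ m ∈ range (h + 1), ((2 * h + 1).choose m : ℤ) = 4 ^ h :=
      mod_cast Nat.sum_range_choose_halfway h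
    rw [sum_range_succ'] at h₁
    simp only [Nat.choose_succ_succ, Nat.cast_add, sum_add_distrib] at h₁
    have h₂ := sum_range_succ (fun m => ((2 * h).choose m : ℤ)) h
    have h₃ := sum_range_succ' (fun m => ((2 * h).choose m : ℤ)) h
    rw [pow_mul]
    simp only [Nat.choose_zero_right, Nat.cast_one, Nat.succ_eq_add_one] at h₁ h₃
    norm_num
    linarith
  -- Here the boundary factor `l - 2h - 1` vanishes.
  · rw [show (2 * h + 1) / 2 = h by omega]
    have h₁ : ∑ m ∈ range (h + 1), ((2 * h + 1).choose m : ℤ) = 4 ^ h :=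
      mod_cast Nat.sum_range_choose_halfway h
    rw [h₁, pow_succ, pow_mul]
    push_cast
    ring


/-! ### Splitting off the strings of length one -/

/-- The number of strings. -/
def count (f : StringMult) : ℕ := f.sum fun _ k => k

/-- The successor map on string lengths. -/
def succEmb : ℕ+ ↪ ℕ+ := ⟨fun n => n + 1, add_left_injective 1⟩

theorem succEmb_apply (n : ℕ+) : succEmb n = n + 1 := rfl

theorem succEmb_ne_one (n : ℕ+) : succEmb n ≠ 1 := by
  intro h
  have := congrArg PNat.val h
  simp [succEmb_apply] at this

/-- Lengthen every string by one and add `k` strings of length one. -/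
noncomputable def cons (k : ℕ) (f : StringMult) : StringMult :=
  Finsupp.single 1 k + f.embDomain succEmb

/-- Remove the strings of length one and shorten the others by one. -/
noncomputable def tail (f : StringMult) : StringMult :=
  f.comapDomain succEmb succEmb.injective.injOn

theorem cons_one (k : ℕ) (f : StringMult) : cons k f 1 = k := by
  have h : (f.embDomain succEmb) 1 = 0 :=
    Finsupp.embDomain_of_notMem_range _ _ _ (by rintro ⟨n, hn⟩; exact succEmb_ne_one n hn)
  simp [cons, h]

theorem cons_succEmb (k : ℕ) (f : StringMult) (n : ℕ+) : cons k f (succEmb n) = f n := by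
  simp [cons, Finsupp.single_eq_of_ne (succEmb_ne_one n)]

theorem tail_cons (k : ℕ) (f : StringMult) : tail (cons k f) = f := by
  ext n
  exact cons_succEmb k f n

theorem cons_tail (f : StringMult) : cons (f 1) (tail f) = f := by
  ext n
  by_cases h : n = 1
  · rw [h, cons_one]
  · obtain ⟨m, rfl⟩ := PNat.exists_eq_succ_of_ne_one h
    exact cons_succEmb (f 1) (tail f) m

theorem prod_cons {R : Type*} [CommMonoid R] (k : ℕ) (f : StringMult) (h : ℕ+ → ℕ → R)
    (h0 : h 1 0 = 1) : (cons k f).prod h = h 1 k * f.prod fun n j => h (n + 1) j := by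
  rw [cons, Finsupp.prod_add_index_of_disjoint, Finsupp.prod_single_index h0,
    Finsupp.prod_embDomain]
  · rfl
  · rw [Finsupp.support_embDomain, Finset.disjoint_left]
    intro n hn hn'
    obtain ⟨m, _, rfl⟩ := Finset.mem_map.1 hn'
    exact succEmb_ne_one m (by simpa using Finsupp.support_single_subset hn)

theorem sum_cons {R : Type*} [AddCommMonoid R] (k : ℕ) (f : StringMult) (h : ℕ+ → ℕ → R)
    (h0 : h 1 0 = 0) : (cons k f).sum h = h 1 k + f.sum fun n j => h (n + 1) j :=
  prod_cons (R := Multiplicative R) k f h h0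

theorem count_cons (k : ℕ) (f : StringMult) : count (cons k f) = k + count f := by
  rw [count, sum_cons _ _ _ rfl, count]

theorem weight_cons (k : ℕ) (f : StringMult) :
    weight (cons k f) = k + count f + weight f := by
  rw [weight, sum_cons _ _ _ (by simp), weight, count, add_assoc, ← Finsupp.sum_add]
  congr 1
  · simp
  · refine Finsupp.sum_congr fun n _ => ?_
    rw [PNat.add_coe, PNat.one_coe]
    ring

theorem excess_cons_one (k : ℕ) (f : StringMult) :
    excess (cons k f) 1 = 2 * (weight f : ℤ) := by
  rw [excess, sum_cons _ _ _ (by simp), weight, Finsupp.sum, Finsupp.sum]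
  rw [if_neg (lt_irrefl _), zero_add, Nat.cast_sum]
  congr 1
  refine Finset.sum_congr rfl fun n _ => ?_
  rw [if_pos (PNat.lt_add_left 1 n)]
  push_cast
  ring

theorem excess_cons_succ (k : ℕ) (f : StringMult) (n : ℕ+) :
    excess (cons k f) (n + 1) = excess f n := by
  rw [excess, sum_cons _ _ _ (by simp), excess, if_neg (by simp), zero_add]
  congr 1
  refine Finsupp.sum_congr fun m _ => ?_
  simp only [add_lt_add_iff_right]
  split_ifs
  · push_cast
    ring
  · rfl

/-- The product of the binomial coefficients of a family of strings; `d` is the part of the upper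
entries that is independent of the family, and the upper entry for length `n` is shifted by
`b * n`. -/
noncomputable def stringProd (b d : ℤ) (f : StringMult) : ℤ :=
  f.prod fun n k => Ring.choose (d + excess f n + (k : ℤ) + b * ((n : ℕ) : ℤ)) k

/-- Shortening preserves the differences `m - n`, so `excess` is unchanged; the shift `b * (n + 1)`
moves one `b` into `d`. -/
theorem stringProd_cons (b d : ℤ) (k : ℕ) (f : StringMult) :
    stringProd b d (cons k f) =
      Ring.choose (d + b + 2 * weight f + k) k * stringProd b (d + b) f := by
  rw [stringProd, prod_cons _ _ _ (Ring.choose_zero_right _), excess_cons_one, stringProd]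
  congr 1
  · congr 1
    rw [PNat.one_coe]
    push_cast
    ring
  · refine Finsupp.prod_congr fun n _ => ?_
    rw [excess_cons_succ]
    congr 1
    rw [PNat.add_coe, PNat.one_coe]
    push_cast
    ring

/-! ### Counting families by weight and number of strings -/

/-- The families of weight `m`. -/
noncomputable def ofWeight (m : ℕ) : Finset StringMult :=
  {f ∈ (finite_weight_le m).toFinset | weight f = m}

theorem mem_ofWeight {m : ℕ} {f : StringMult} : f ∈ ofWeight m ↔ weight f = m := by
  simp only [ofWeight, mem_filter, Set.Finite.mem_toFinset, Set.mem_ofPred_eq]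
  exact ⟨fun h => h.2, fun h => ⟨h.le, h⟩⟩

theorem count_le_weight (f : StringMult) : count f ≤ weight f :=
  Finset.sum_le_sum fun n _ => Nat.le_mul_of_pos_left _ n.pos

theorem count_eq_zero {f : StringMult} : count f = 0 ↔ f = 0 := by
  refine ⟨fun h => ?_, fun h => by simp [h, count]⟩
  ext n
  by_contra hn
  exact hn (Finset.sum_eq_zero_iff.1 h n (Finsupp.mem_support_iff.2 hn))

/-- The sum of `stringProd` over the families of weight `m` with `q` strings. -/
noncomputable def stringSum (b a : ℤ) (m q : ℕ) : ℤ :=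
  ∑ f ∈ ofWeight m with count f = q, stringProd b (a - 2 * m) f

theorem stringSum_zero (b a : ℤ) (m : ℕ) :
    stringSum b a m 0 = compositionCount m 0 := by
  cases m with
  | zero =>
    rw [stringSum, sum_eq_single_of_mem 0]
    · simp [stringProd, compositionCount]
    · rw [mem_filter, mem_ofWeight]
      simp [weight, count]
    · intro f hf h
      exact absurd (count_eq_zero.1 (mem_filter.1 hf).2) h
  | succ m =>
    rw [stringSum, sum_eq_zero]
    · simp [compositionCount]
    · intro f hf
      obtain ⟨h₁, h₂⟩ := mem_filter.1 hf
      rw [mem_ofWeight, count_eq_zero.1 h₂] at h₁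
      simp [weight] at h₁

theorem stringSum_of_lt (b a : ℤ) {m q : ℕ} (h : m < q) : stringSum b a m q = 0 := by
  refine sum_eq_zero fun f hf => ?_
  obtain ⟨h₁, h₂⟩ := mem_filter.1 hf
  rw [mem_ofWeight] at h₁
  have := count_le_weight f
  omega

/-- Of the `q` strings, `k` are longer than one and survive the shortening, which removes `q` from
the weight. -/
theorem stringSum_recursion (b a : ℤ) (s q : ℕ) :
    stringSum b a (s + q) q = ∑ k ∈ range (q + 1),
      Ring.choose (a + b - q - k) (q - k) * stringSum b (a + b - 2 * q) s k := by
  simp only [stringSum, mul_sum]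
  rw [sum_sigma']
  symm
  refine sum_bij' (fun x _ => cons (q - x.1) x.2) (fun f _ => ⟨count (tail f), tail f⟩)
    ?_ ?_ ?_ ?_ ?_
  · rintro ⟨k, f⟩ h
    simp only [mem_sigma, mem_range, mem_filter, mem_ofWeight] at h ⊢
    rw [weight_cons, count_cons]
    omega
  · intro f h
    simp only [mem_sigma, mem_range, mem_filter, mem_ofWeight] at h ⊢
    have h₁ := weight_cons (f 1) (tail f)
    have h₂ := count_cons (f 1) (tail f)
    rw [cons_tail] at h₁ h₂
    refine ⟨?_, ?_, trivial⟩ <;> omega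
  · rintro ⟨k, f⟩ h
    simp only [mem_sigma, mem_filter] at h
    simp only [tail_cons, h.2.2]
  · intro f h
    simp only [mem_filter] at h
    have h₂ := count_cons (f 1) (tail f)
    rw [cons_tail] at h₂
    have h₃ : q - count (tail f) = f 1 := by omega
    simp only [h₃, cons_tail]
  · rintro ⟨k, f⟩ h
    simp only [mem_sigma, mem_range, mem_filter, mem_ofWeight] at h
    obtain ⟨hk, hf, -⟩ := h
    simp only [stringProd_cons, hf]
    congr 2
    · push_cast [Nat.cast_sub (Nat.lt_succ_iff.1 hk)]
      ring
    · push_cast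
      ring

/-- For `q ≠ 0` the recursion lowers the weight, so it determines the sums from the boundary values.
-/
theorem stringSum_eq (b : ℤ) (F : ℤ → ℕ → ℕ → ℤ)
    (hzero : ∀ a m, F a m 0 = compositionCount m 0)
    (hlt : ∀ a m q, m < q → F a m q = 0)
    (hrec : ∀ a s q, q ≠ 0 → ∑ k ∈ range (q + 1),
      Ring.choose (a + b - q - k) (q - k) * F (a + b - 2 * q) s k = F a (s + q) q)
    (a : ℤ) (m q : ℕ) : stringSum b a m q = F a m q := by
  induction m using Nat.strong_induction_on generalizing a q with
  | _ m ih =>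
    rcases eq_or_ne q 0 with rfl | hq
    · rw [stringSum_zero, hzero]
    · rcases lt_or_ge m q with h | h
      · rw [stringSum_of_lt b a h, hlt a m q h]
      · obtain ⟨s, rfl⟩ := Nat.exists_eq_add_of_le' h
        rw [stringSum_recursion, ← hrec a s q hq]
        exact sum_congr rfl fun k _ => by rw [ih s (by omega)]

theorem compositionCount_of_lt {m q : ℕ} (h : m < q) : compositionCount m q = 0 := by
  obtain ⟨r, rfl⟩ := Nat.exists_eq_succ_of_ne_zero (Nat.ne_zero_of_lt h)
  cases m with
  | zero => rfl
  | succ m => exact Nat.choose_eq_zero_of_lt (by omega)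

theorem shiftedClosed_zero (a : ℤ) (m : ℕ) : shiftedClosed a m 0 = compositionCount m 0 := by
  simp [shiftedClosed]

theorem shiftedClosed_of_lt (a : ℤ) {m q : ℕ} (h : m < q) : shiftedClosed a m q = 0 := by
  simp [shiftedClosed, compositionCount_of_lt h]

theorem correction_of_lt (a : ℤ) {m q : ℕ} (h : m < q) : correction a m q = 0 := by
  obtain ⟨r, rfl⟩ := Nat.exists_eq_succ_of_ne_zero (Nat.ne_zero_of_lt h)
  simp [correction, Nat.choose_eq_zero_of_lt h]

theorem sum_ofWeight (b a : ℤ) (m : ℕ) :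
    ∑ f ∈ ofWeight m, stringProd b (a - 2 * m) f = ∑ q ∈ range (m + 1), stringSum b a m q := by
  symm
  refine sum_fiberwise_of_maps_to (fun f hf => ?_) _
  rw [mem_ofWeight] at hf
  have := count_le_weight f
  simp only [mem_range]
  omega

theorem sum_stringProd_zero (a : ℤ) (m : ℕ) :
    ∑ f ∈ ofWeight m, stringProd 0 (a - 2 * m) f = ballot a m := by
  rw [sum_ofWeight, ← sum_closed]
  refine sum_congr rfl fun q _ =>
    stringSum_eq 0 (fun a m q => shiftedClosed a m q - correction a m q) ?_ ?_ ?_ a m q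
  · intro a m
    simp [shiftedClosed_zero, correction]
  · intro a m q h
    simp [shiftedClosed_of_lt a h, correction_of_lt a h]
  · intro a s q hq
    simpa only [add_zero] using closed_recursion a s q hq

theorem sum_stringProd_one (a : ℤ) (m : ℕ) :
    ∑ f ∈ ofWeight m, stringProd 1 (a - 2 * m) f = Ring.choose a m := by
  rw [sum_ofWeight, ← sum_shiftedClosed]
  exact sum_congr rfl fun q _ => stringSum_eq 1 shiftedClosed shiftedClosed_zero
    (fun a _ _ h => shiftedClosed_of_lt a h) shiftedClosed_recursion a m q


/-! ### Summation over configurations -/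

theorem sum_configs {N M : ℕ} (h : 2 * M ≤ N) (G : ℕ → StringMult → StringMult → ℤ) :
    ∑ c ∈ (configs_finite N M).toFinset, G c.Nr c.M' c.M =
      ∑ w ∈ range (M + 1), ∑ f ∈ ofWeight w, ∑ g ∈ ofWeight (M - w), G (N - 2 * w) f g := by
  simp only [sum_sigma']
  refine sum_bij' (fun c _ => ⟨weight c.M', c.M', c.M⟩)
    (fun x _ => ⟨N - 2 * x.1, x.2.2, x.2.1⟩) ?_ ?_ ?_ ?_ ?_
  · rintro ⟨r, f, g⟩ hc
    simp only [Set.Finite.mem_toFinset, configs, Set.mem_ofPred_eq] at hc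
    simp only [mem_sigma, mem_range, mem_ofWeight]
    exact ⟨by omega, trivial, by omega⟩
  · rintro ⟨w, f, g⟩ hx
    simp only [mem_sigma, mem_range, mem_ofWeight] at hx
    simp only [Set.Finite.mem_toFinset, configs, Set.mem_ofPred_eq]
    omega
  · rintro ⟨r, f, g⟩ hc
    simp only [Set.Finite.mem_toFinset, configs, Set.mem_ofPred_eq] at hc
    simp only [Config.mk.injEq, and_true]
    omega
  · rintro ⟨w, f, g⟩ hx
    simp only [mem_sigma, mem_range, mem_ofWeight] at hx
    obtain ⟨-, rfl, -⟩ := hx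
    rfl
  · rintro ⟨r, f, g⟩ hc
    simp only [Set.Finite.mem_toFinset, configs, Set.mem_ofPred_eq] at hc
    rw [show N - 2 * weight g = r by omega]

theorem sum_configs_stringProd (b b' : ℤ) (L : ℕ) {N M : ℕ} (h : 2 * M ≤ N) :
    ∑ c ∈ (configs_finite N M).toFinset, (L.choose c.Nr : ℤ) *
        (stringProd b (L - N) c.M' * stringProd b' (N - 2 * M) c.M) =
      ∑ w ∈ range (M + 1), (L.choose (N - 2 * w) : ℤ) *
        ((∑ f ∈ ofWeight w, stringProd b ((L - (N - 2 * w : ℕ) : ℤ) - 2 * w) f) *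
          ∑ g ∈ ofWeight (M - w), stringProd b' ((N - 2 * w : ℕ) - 2 * (M - w : ℕ)) g) := by
  rw [sum_configs h fun r f g => (L.choose r : ℤ) *
    (stringProd b (L - N) f * stringProd b' (N - 2 * M) g)]
  refine sum_congr rfl fun w hw => ?_
  simp only [mem_range] at hw
  rw [sum_mul_sum, mul_sum]
  refine sum_congr rfl fun f _ => ?_
  rw [mul_sum]
  refine sum_congr rfl fun g _ => ?_
  push_cast [Nat.cast_sub (show 2 * w ≤ N by omega), Nat.cast_sub (show w ≤ M by omega)]
  ring_nf

theorem Z_eq (L : ℕ) {N M : ℕ} (h : 2 * M ≤ N) :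
    Z L N M = ∑ w ∈ range (M + 1), (L.choose (N - 2 * w) : ℤ) *
      (ballot (L - (N - 2 * w : ℕ)) w * ballot (N - 2 * w : ℕ) (M - w)) := by
  simp only [← sum_stringProd_zero]
  rw [← sum_configs_stringProd 0 0 L h]
  simp only [Z, stringProd, P, P', zero_mul, add_zero]

theorem Ztilde_eq (L : ℕ) {N M : ℕ} (h : 2 * M ≤ N) :
    Ztilde L N M = ∑ w ∈ range (M + 1), (L.choose (N - 2 * w) : ℤ) *
      (Ring.choose (L - (N - 2 * w : ℕ) : ℤ) w * ballot (N - 2 * w : ℕ) (M - w)) := by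
  simp only [← sum_stringProd_zero, ← sum_stringProd_one]
  rw [← sum_configs_stringProd 1 0 L h]
  simp only [Ztilde, stringProd, P, P', zero_mul, add_zero, one_mul]

/-! ### Summing to the dimension -/

/-- Change of variables from `(N, M, w)` to `(N - 2 * w, w, M - w)`. -/
theorem sum_range_reindex (B : ℕ) (A C : ℕ → ℕ → ℤ) :
    ∑ N ∈ range (B + 1), ∑ M ∈ range (N / 2 + 1), ∑ w ∈ range (M + 1),
        A (N - 2 * w) w * C (N - 2 * w) (M - w) =
      ∑ r ∈ range (B + 1), (∑ w ∈ range ((B - r) / 2 + 1), A r w) *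
        ∑ m ∈ range (r / 2 + 1), C r m := by
  simp only [sum_mul_sum, sum_sigma']
  refine sum_bij' (fun x _ => ⟨x.1 - 2 * x.2.2, x.2.2, x.2.1 - x.2.2⟩)
    (fun x _ => ⟨x.1 + 2 * x.2.1, x.2.2 + x.2.1, x.2.1⟩) ?_ ?_ ?_ ?_ ?_
  · rintro ⟨N, M, w⟩ h
    simp only [mem_sigma, mem_range] at h ⊢
    omega
  · rintro ⟨r, w, m⟩ h
    simp only [mem_sigma, mem_range] at h ⊢
    omega
  · rintro ⟨N, M, w⟩ h
    simp only [mem_sigma, mem_range] at h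
    simp only [Sigma.mk.injEq, heq_eq_eq, and_true]
    omega
  · rintro ⟨r, w, m⟩ h
    simp only [Nat.add_sub_cancel]
  · rintro ⟨N, M, w⟩ h
    rfl

theorem sum_choose_mul_two_pow (L : ℕ) :
    ∑ r ∈ range (L + 1), (L.choose r : ℤ) * 2 ^ (L - r) * 2 ^ r = 4 ^ L := by
  have h : ∀ r ∈ range (L + 1), (L.choose r : ℤ) * 2 ^ (L - r) * 2 ^ r = L.choose r * 2 ^ L := by
    intro r hr
    rw [mul_assoc, ← pow_add, Nat.sub_add_cancel (Nat.lt_succ_iff.1 (mem_range.1 hr))]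
  rw [sum_congr rfl h, ← sum_mul, ← Nat.cast_sum, Nat.sum_range_choose]
  push_cast
  rw [← mul_pow]
  norm_num

theorem sum_Z (L : ℕ) :
    ∑ N ∈ range (L + 1), ∑ M ∈ range (N / 2 + 1),
      ((L : ℤ) - N + 1) * ((N : ℤ) - 2 * M + 1) * Z L N M = 4 ^ L := by
  rw [← sum_choose_mul_two_pow]
  refine Eq.trans (sum_congr rfl fun N _ => sum_congr rfl fun M hM => ?_) <|
    (sum_range_reindex L
      (fun r w => (L.choose r : ℤ) * ((L - r : ℤ) - 2 * w + 1) * ballot (L - r) w)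
      (fun r m => ((r : ℤ) - 2 * m + 1) * ballot r m)).trans (sum_congr rfl fun r hr => ?_)
  · simp only [mem_range] at hM
    rw [Z_eq L (by omega), mul_sum]
    refine sum_congr rfl fun w hw => ?_
    simp only [mem_range] at hw
    push_cast [Nat.cast_sub (show 2 * w ≤ N by omega), Nat.cast_sub (show w ≤ M by omega)]
    ring
  · have hr' : r ≤ L := Nat.lt_succ_iff.1 (mem_range.1 hr)
    simp only [mul_assoc]
    rw [sum_mul_ballot, ← mul_sum, ← Nat.cast_sub hr', sum_mul_ballot, mul_assoc]

theorem sum_Ztilde (L : ℕ) :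
    ∑ N ∈ range (2 * L + 1), ∑ M ∈ range (N / 2 + 1),
      ((N : ℤ) - 2 * M + 1) * Ztilde L N M = 4 ^ L := by
  rw [← sum_choose_mul_two_pow]
  refine Eq.trans (sum_congr rfl fun N _ => sum_congr rfl fun M hM => ?_) <|
    (sum_range_reindex (2 * L)
      (fun r w => (L.choose r : ℤ) * Ring.choose (L - r : ℤ) w)
      (fun r m => ((r : ℤ) - 2 * m + 1) * ballot r m)).trans ?_
  · simp only [mem_range] at hM
    rw [Ztilde_eq L (by omega), mul_sum]
    refine sum_congr rfl fun w hw => ?_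
    simp only [mem_range] at hw
    push_cast [Nat.cast_sub (show 2 * w ≤ N by omega), Nat.cast_sub (show w ≤ M by omega)]
    ring
  · symm
    -- Terms with `r > L` vanish because of `L.choose r`.
    have hsub : range (L + 1) ⊆ range (2 * L + 1) := range_subset_range.2 (by omega)
    rw [← sum_subset hsub]
    · refine sum_congr rfl fun r hr => ?_
      have hr' : r ≤ L := Nat.lt_succ_iff.1 (mem_range.1 hr)
      rw [sum_mul_ballot, ← mul_sum, ← Nat.cast_sub hr']
      congr 2
      -- The bound `N ≤ 2 * L` lets `w` run through the whole row of `L - r`; further entries are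
      -- zero.
      have hsub' : range (L - r + 1) ⊆ range ((2 * L - r) / 2 + 1) :=
        range_subset_range.2 (by omega)
      simp only [Ring.choose_natCast]
      rw [← sum_subset hsub', ← Nat.cast_sum, Nat.sum_range_choose]
      · push_cast
        rfl
      · intro w _ hw
        rw [Nat.choose_eq_zero_of_lt (by simp only [mem_range] at hw; omega), Nat.cast_zero]
    · intro r _ hr
      rw [Nat.choose_eq_zero_of_lt (by simp only [mem_range] at hr; omega)]
      simp

end HubbardBethe

theorem corollary1 (L : ℕ) :
    Module.finrank ℂ (HubbardBethe.FockSpace L) = 4 ^ L ∧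
    (Module.finrank ℂ (HubbardBethe.FockSpace L) : ℤ) =
      ∑ N ∈ Finset.range (L + 1), ∑ M ∈ Finset.range (N / 2 + 1),
        ((L : ℤ) - (N : ℤ) + 1) * ((N : ℤ) - 2 * (M : ℤ) + 1) * HubbardBethe.Z L N M ∧
    (Module.finrank ℂ (HubbardBethe.FockSpace L) : ℤ) =
      ∑ N ∈ Finset.range (2 * L + 1), ∑ M ∈ Finset.range (N / 2 + 1),
        ((N : ℤ) - 2 * (M : ℤ) + 1) * HubbardBethe.Ztilde L N M := by
  rw [HubbardBethe.sum_Z, HubbardBethe.sum_Ztilde, HubbardBethe.finrank_fockSpace]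
  exact ⟨rfl, by push_cast; rfl, by push_cast; rfl⟩
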